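/- For $d\in\mathbb{N}$ order $\mathbb{Z}^d$ componentwise. For $A\subseteq\mathbb{Z}^d$ let $\mathrm{per}_{\geq 0}(A)$ be the set of all finite sums $a_1+\cdots+a_k$ with $k\in\mathbb{N}$ and $a_1,\dots,a_k\in A$ such that $\sum_{\ell=1}^{j}a_\ell\geq 0$ for every $j\in\{0,\dots,k\}$. A set $P\subseteq\mathbb{Z}^d$ is periodic if $0\in P$ and $P+P\subseteq P$; it is a finitely generated periodic set if, moreover, there is a finite set $X\subseteq\mathbb{Z}^d$ such that $P$ is the set of all finite sums (including the empty sum, and with repetitions allowed) of elements of $X$. Then the following hold. (1) For every finite set $A\subseteq\mathbb{Z}^2$, the set $\mathrm{per}_{\geq 0}(A)$ is a finitely generated periodic set. (2) This fails in dimension $3$: for $A=\{(1,1,1),(-1,2,0),(-1,0,0),(2,-1,0),(0,-1,0)\}\subseteq\mathbb{Z}^3$ one has $\mathrm{per}_{\geq 0}(A)=\{(0,0,0)\}\cup(\mathbb{N}^2\times\mathbb{N}_{>0})$, and this set is not a finitely generated periodic set. (3) More generally, for every $d\geq 3$ there is a finite set $A\subseteq\mathbb{Z}^d$ such that $\mathrm{per}_{\geq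 0}(A)$ is not a finitely generated periodic set. -/

import Mathlib

/-- The set of finite sums `a₁ + ⋯ + aₖ` (`k ∈ ℕ`) of elements of `A` all of whose partial sums
`a₁ + ⋯ + aⱼ`, `0 ≤ j ≤ k`, are nonnegative. On `Fin d → ℤ` the order is componentwise. -/
def perPos {M : Type*} [AddCommMonoid M] [PartialOrder M] (A : Set M) : Set M :=
  {x | ∃ l : List M, (∀ a ∈ l, a ∈ A) ∧ (∀ j ≤ l.length, 0 ≤ (l.take j).sum) ∧ l.sum = x}

/-- A periodic set: it contains `0` and is closed under addition. -/
def IsPeriodicSet {M : Type*} [AddCommMonoid M] (P : Set M) : Prop :=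
  0 ∈ P ∧ ∀ u ∈ P, ∀ v ∈ P, u + v ∈ P

/-- A finitely generated periodic set: a periodic set that equals the set of all finite sums
(with repetitions, the empty sum included) of elements of some finite set `X`. -/
def IsFGPeriodicSet {M : Type*} [AddCommMonoid M] (P : Set M) : Prop :=
  IsPeriodicSet P ∧ ∃ X : Set M, X.Finite ∧ P = (AddSubmonoid.closure X : Set M)

/-! ### Sums with nonnegative partial sums -/

section Basic

variable {M : Type*} [AddCommMonoid M] [PartialOrder M] {A : Set M}

/-! In the plane, a periodic set whose cone has both extreme rays attained by its own elements is
finitely generated, by Dickson's lemma (`IsPeriodicSet.isFG_of_cone`). The rays are attained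
(`exists_extreme_mem_perPos`): either some element lies on the axis, possibly after jumping down
from a positive vector, or the whole of `A` lies on one side of its positive vector closest to the
axis.

In dimension 3, the third coordinate is a switch: only `(1,1,1)` can come first, and afterwards
every point of the quadrant is reachable at that height. So height 1 holds infinitely many elements,
none of them a sum of two nonzero ones. Padding with zeros gives all larger `d`. -/

theorem zero_mem_perPos : (0 : M) ∈ perPos A :=
  ⟨[], by simp, by simp, rfl⟩

theorem perPos_nonneg {x : M} (hx : x ∈ perPos A) : 0 ≤ x := by
  obtain ⟨l, -, h, rfl⟩ := hx
  simpa using h l.length le_rfl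

theorem perPos_mem_induction {p : M → Prop} (zero : p 0)
    (add : ∀ x a, a ∈ A → p x → p (a + x)) {x : M} (hx : x ∈ perPos A) : p x := by
  obtain ⟨l, hl, -, rfl⟩ := hx
  induction l with
  | nil => simpa using zero
  | cons a l ih =>
    rw [List.sum_cons]
    exact add _ _ (hl a (by simp)) (ih fun b hb => hl b (by simp [hb]))

theorem add_mem_perPos_of_mem {x a : M} (hx : x ∈ perPos A) (ha : a ∈ A) (h : 0 ≤ x + a) :
    x + a ∈ perPos A := by
  obtain ⟨l, hl, hp, rfl⟩ := hx
  refine ⟨l ++ [a], ?_, ?_, by simp⟩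
  · intro b hb
    rcases List.mem_append.1 hb with hb | hb
    · exact hl b hb
    · rw [List.mem_singleton.1 hb]; exact ha
  · intro j hj
    rcases Nat.lt_or_ge l.length j with hj' | hj'
    · rw [List.take_of_length_le (by simp; omega)]
      simpa using h
    · rw [List.take_append_of_le_length hj']
      exact hp j hj'

theorem mem_perPos_of_mem {a : M} (ha : a ∈ A) (h : 0 ≤ a) : a ∈ perPos A := by
  simpa using add_mem_perPos_of_mem zero_mem_perPos ha (by simpa using h)

theorem isPeriodicSet_perPos [IsOrderedAddMonoid M] : IsPeriodicSet (perPos A) := by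
  refine ⟨zero_mem_perPos, ?_⟩
  rintro _ ⟨l, hl, hp, rfl⟩ _ ⟨m, hm, hq, rfl⟩
  refine ⟨l ++ m, ?_, ?_, by simp⟩
  · intro b hb
    rcases List.mem_append.1 hb with hb | hb
    exacts [hl b hb, hm b hb]
  · intro j hj
    rw [List.take_append, List.sum_append]
    refine add_nonneg ?_ (hq _ (by simp at hj; omega))
    rcases Nat.lt_or_ge l.length j with hj' | hj'
    · rw [List.take_of_length_le hj'.le]
      simpa using hp l.length le_rfl
    · exact hp j hj'

end Basic

section Periodic

variable {M : Type*} [AddCommMonoid M]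

/-- The submonoid underlying a periodic set. -/
def IsPeriodicSet.toAddSubmonoid {P : Set M} (h : IsPeriodicSet P) : AddSubmonoid M where
  carrier := P
  zero_mem' := h.1
  add_mem' ha hb := h.2 _ ha _ hb

theorem IsPeriodicSet.nsmul_mem {P : Set M} (h : IsPeriodicSet P) {x : M} (hx : x ∈ P) (n : ℕ) :
    n • x ∈ P :=
  AddSubmonoid.nsmul_mem h.toAddSubmonoid hx n

theorem IsPeriodicSet.closure_subset {P X : Set M} (h : IsPeriodicSet P) (hX : X ⊆ P) :
    (AddSubmonoid.closure X : Set M) ⊆ P :=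
  (AddSubmonoid.closure_le (S := h.toAddSubmonoid)).2 hX

end Periodic

/-! ### Finite generation from two extreme rays -/

section Cone

/-- A periodic set that lies, up to a bounded denominator, in the cone spanned by two of its
elements is finitely generated. -/
theorem IsPeriodicSet.isFG_of_cone {M : Type*} [AddCommGroup M] [IsAddTorsionFree M] {P : Set M} (hP : IsPeriodicSet P) {u w : M} (hu : u ∈ P) (hw : w ∈ P)
    {D : ℕ} (hD : 0 < D) (h : ∀ v ∈ P, ∃ α β : ℕ, D • v = α • u + β • w) :
    IsFGPeriodicSet P := by
  refine ⟨hP, ?_⟩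
  -- Coefficients are sorted by residue `r` mod `D`; with `r` fixed, raising the quotient pair `q`
  -- amounts to adding copies of `u` and `w`. Hence minimal pairs suffice.
  let S : ℕ × ℕ → Set (ℕ × ℕ) := fun r =>
    {q | ∃ v ∈ P, D • v = (D * q.1 + r.1) • u + (D * q.2 + r.2) • w}
  let B : ℕ × ℕ → Set (ℕ × ℕ) := fun r => {q | Minimal (· ∈ S r) q}
  have hB : ∀ r, (B r).Finite := fun r =>
    (setOfPred_minimal_antichain _).finite_of_partiallyWellOrderedOn
      (Set.isPWO_of_wellQuasiOrderedLE (B r))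
  let X : Set M := {u, w} ∪ ⋃ r ∈ Set.Iio D ×ˢ Set.Iio D, ⋃ q ∈ B r,
    {v | v ∈ P ∧ D • v = (D * q.1 + r.1) • u + (D * q.2 + r.2) • w}
  have hinj : Function.Injective fun v : M => D • v := nsmul_right_injective hD.ne'
  have hX : X ⊆ P := by
    intro x hx
    rcases hx with hx | hx
    · rcases hx with rfl | rfl
      exacts [hu, hw]
    · simp only [Set.mem_iUnion] at hx
      obtain ⟨-, -, -, -, hx, -⟩ := hx
      exact hx
  refine ⟨X, ?_, ?_⟩
  · refine (Set.toFinite _).union (Set.Finite.biUnion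
      ((Set.finite_Iio D).prod (Set.finite_Iio D)) fun r _ => (hB r).biUnion fun q _ => ?_)
    refine Set.Subsingleton.finite ?_
    rintro x ⟨-, hx⟩ y ⟨-, hy⟩
    exact hinj (hx.trans hy.symm)
  · refine Set.Subset.antisymm ?_ (hP.closure_subset hX)
    intro v hv
    obtain ⟨α, β, hαβ⟩ := h v hv
    have hmem : (α / D, β / D) ∈ S (α % D, β % D) :=
      ⟨v, hv, by simp only [Nat.div_add_mod]; exact hαβ⟩
    obtain ⟨⟨a, b⟩, hle, hmin⟩ := exists_minimal_le_of_wellFoundedLT (· ∈ S (α % D, β % D)) _ hmem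
    obtain ⟨v', hv', hv'D⟩ := hmin.prop
    have hX' : v' ∈ X := by
      refine Or.inr ?_
      simp only [Set.mem_iUnion]
      exact ⟨(α % D, β % D), ⟨Nat.mod_lt _ hD, Nat.mod_lt _ hD⟩, (a, b), hmin, hv', hv'D⟩
    obtain ⟨c, hc⟩ := Nat.exists_eq_add_of_le hle.1
    obtain ⟨e, he⟩ := Nat.exists_eq_add_of_le hle.2
    have hveq : v = v' + c • u + e • w := by
      apply hinj
      simp only [smul_add, hv'D, hαβ]
      simp only at hc he
      conv_lhs => rw [← Nat.div_add_mod α D, ← Nat.div_add_mod β D, hc, he]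
      simp only [mul_add, add_smul, mul_smul]
      abel
    rw [hveq]
    have huX : u ∈ AddSubmonoid.closure X := AddSubmonoid.subset_closure (Or.inl (by simp))
    have hwX : w ∈ AddSubmonoid.closure X := AddSubmonoid.subset_closure (Or.inl (by simp))
    exact add_mem (add_mem (AddSubmonoid.subset_closure hX') (AddSubmonoid.nsmul_mem _ huX _))
      (AddSubmonoid.nsmul_mem _ hwX _)

end Cone

/-! ### Dimension two -/

section Plane

theorem Pi.nsmul_apply_int {ι : Type*} (n : ℕ) (v : ι → ℤ) (k : ι) : (n • v) k = n * v k := by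
  simp

/-- Each coordinate is monotone along the segment, so nonnegativity at both ends suffices. -/
theorem add_nsmul_mem_perPos {ι : Type*} {A : Set (ι → ℤ)} {x b : ι → ℤ} (hx : x ∈ perPos A)
    (hb : b ∈ A) (n : ℕ) (h : 0 ≤ x + n • b) : x + n • b ∈ perPos A := by
  induction n with
  | zero => simpa using hx
  | succ n ih =>
    have hn : 0 ≤ x + n • b := by
      intro k
      have h1 := perPos_nonneg hx k
      have h2 := h k
      simp only [Pi.add_apply, Pi.nsmul_apply_int, Pi.zero_apply] at h1 h2 ⊢
      push_cast at h2
      rcases le_or_gt 0 (b k) with hk | hk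
      · positivity
      · linarith
    rw [succ_nsmul, ← add_assoc] at h ⊢
    exact add_mem_perPos_of_mem (ih hn) hb h

/-- If `perPos A` contains a vector with positive coordinates, then it contains a nonzero vector
that is extreme towards the `i`-th axis. -/
theorem exists_extreme_mem_perPos {A : Set (Fin 2 → ℤ)} (hA : A.Finite) {i j : Fin 2}
    (hij : ∀ k, k = i ∨ k = j) {x : Fin 2 → ℤ} (hx : x ∈ perPos A) (hxi : 0 < x i)
    (hxj : 0 < x j) :
    ∃ u ∈ perPos A, 0 < u i ∧ ∀ v ∈ perPos A, 0 ≤ u i * v j - u j * v i := by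
  have nonneg : ∀ v : Fin 2 → ℤ, 0 ≤ v i → 0 ≤ v j → 0 ≤ v := fun v h1 h2 k => by
    rcases hij k with rfl | rfl
    exacts [h1, h2]
  have axis : ∀ u ∈ perPos A, 0 < u i → u j = 0 →
      ∃ u ∈ perPos A, 0 < u i ∧ ∀ v ∈ perPos A, 0 ≤ u i * v j - u j * v i := by
    refine fun u hu h1 h2 => ⟨u, hu, h1, fun v hv => ?_⟩
    rw [h2, zero_mul, sub_zero]
    exact mul_nonneg h1.le (perPos_nonneg hv j)
  -- a jump `b` down to the axis from a multiple of `a`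
  have jump : ∀ a ∈ perPos A, 0 < a j → ∀ b ∈ A, b j < 0 → 0 < a i * (-b j) + a j * b i →
      ∃ u ∈ perPos A, 0 < u i ∧ ∀ v ∈ perPos A, 0 ≤ u i * v j - u j * v i := by
    intro a ha haj b hb hbj hpos
    have e1 : (((-b j).toNat : ℕ) : ℤ) = -b j := Int.toNat_of_nonneg (by omega)
    have e2 : (((a j).toNat : ℕ) : ℤ) = a j := Int.toNat_of_nonneg haj.le
    have ei : ((-b j).toNat • a + (a j).toNat • b) i = a i * (-b j) + a j * b i := by
      simp only [Pi.add_apply, Pi.nsmul_apply_int, e1, e2]; ring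
    have ej : ((-b j).toNat • a + (a j).toNat • b) j = 0 := by
      simp only [Pi.add_apply, Pi.nsmul_apply_int, e1, e2]; ring
    exact axis _ (add_nsmul_mem_perPos (isPeriodicSet_perPos.nsmul_mem ha _) hb _
      (nonneg _ (by rw [ei]; exact hpos.le) ej.ge)) (by rw [ei]; exact hpos) ej
  by_cases h1 : ∃ a ∈ A, a j = 0 ∧ 0 < a i
  · obtain ⟨a, ha, haj, hai⟩ := h1
    exact axis a (mem_perPos_of_mem ha (nonneg a hai.le haj.ge)) hai haj
  by_cases h2 : ∃ b ∈ A, b j < 0 ∧ 0 ≤ b i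
  · obtain ⟨b, hb, hbj, hbi⟩ := h2
    have := mul_pos hxi (neg_pos.2 hbj)
    have := mul_nonneg hxj.le hbi
    exact jump x hx hxj b hb hbj (by linarith)
  by_cases h3 : ∃ a ∈ A, ∃ b ∈ A, 0 < a i ∧ 0 < a j ∧ b j < 0 ∧ 0 < a i * (-b j) + a j * b i
  · obtain ⟨a, ha, b, hb, hai, haj, hbj, h⟩ := h3
    exact jump a (mem_perPos_of_mem ha (nonneg a hai.le haj.le)) haj b hb hbj h
  push Not at h1 h2 h3
  have hne : ∃ a ∈ A, 0 < a i ∧ 0 < a j := by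
    by_contra! hcon
    have hA0 : ∀ a ∈ A, a i ≤ 0 := by
      intro a ha
      by_contra! hai
      rcases lt_trichotomy (a j) 0 with hj | hj | hj
      · exact absurd (h2 a ha hj) (by omega)
      · exact absurd (h1 a ha hj) (by omega)
      · exact absurd (hcon a ha hai) (by omega)
    have : x i ≤ 0 := perPos_mem_induction (p := fun v => v i ≤ 0) le_rfl
      (fun y a ha hy => add_nonpos (hA0 a ha) hy) hx
    omega
  have hfin : (A ∩ {a | 0 < a i ∧ 0 < a j}).Finite := hA.inter_of_left _
  -- No jump reaches the axis, so the positive vector of least slope bounds all of `A`, hence all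
  -- its sums.
  obtain ⟨a, ⟨ha, hai, haj⟩, hmin⟩ := Set.exists_min_image _ (fun a => (a j : ℚ) / a i) hfin
    (by obtain ⟨a, h, h'⟩ := hne; exact ⟨a, h, h'⟩)
  have hA0 : ∀ c ∈ A, 0 ≤ a i * c j - a j * c i := by
    intro c hc
    rcases lt_trichotomy (c j) 0 with hj | hj | hj
    · linarith [h3 a ha c hc hai haj hj]
    · rw [hj, mul_zero, zero_sub, ← mul_neg]
      exact mul_nonneg haj.le (by linarith [h1 c hc hj])
    · rcases le_or_gt (c i) 0 with hi | hi
      · have := mul_pos hai hj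
        have := mul_nonneg haj.le (neg_nonneg.2 hi)
        linarith
      · have := hmin c ⟨hc, hi, hj⟩
        rw [div_le_div_iff₀ (by exact_mod_cast hai) (by exact_mod_cast hi)] at this
        have : a j * c i ≤ c j * a i := by exact_mod_cast this
        linarith
  refine ⟨a, mem_perPos_of_mem ha (nonneg a hai.le haj.le), hai, fun v hv =>
    perPos_mem_induction (p := fun v => 0 ≤ a i * v j - a j * v i) (by simp) ?_ hv⟩
  intro y c hc hy
  have := hA0 c hc
  simp only [Pi.add_apply]
  linarith

/-- The cone lemma with both rays equal to `u`: collinearity gives `(u 0 + u 1) • v = (v 0 + v 1) •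
u`. -/
theorem IsPeriodicSet.isFG_of_collinear {P : Set (Fin 2 → ℤ)} (hP : IsPeriodicSet P)
    (hnn : ∀ v ∈ P, 0 ≤ v) {u : Fin 2 → ℤ} (hu : u ∈ P) (hu0 : u ≠ 0)
    (h : ∀ v ∈ P, u 0 * v 1 = u 1 * v 0) : IsFGPeriodicSet P := by
  have h0 := hnn u hu 0
  have h1 := hnn u hu 1
  simp only [Pi.zero_apply] at h0 h1
  have hpos : 0 < u 0 + u 1 := by
    by_contra hcon
    apply hu0
    ext k
    fin_cases k <;> simp <;> omega
  refine hP.isFG_of_cone hu hu (D := (u 0 + u 1).toNat) (by omega) fun v hv =>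
    ⟨(v 0 + v 1).toNat, 0, ?_⟩
  have v0 := hnn v hv 0
  have v1 := hnn v hv 1
  simp only [Pi.zero_apply] at v0 v1
  have e1 : (((u 0 + u 1).toNat : ℕ) : ℤ) = u 0 + u 1 := Int.toNat_of_nonneg hpos.le
  have e2 : (((v 0 + v 1).toNat : ℕ) : ℤ) = v 0 + v 1 := Int.toNat_of_nonneg (by omega)
  have := h v hv
  refine funext (Fin.forall_fin_two.2 ⟨?_, ?_⟩) <;>
    simp only [Pi.add_apply, Pi.nsmul_apply_int, e1, e2] <;> push_cast <;> linarith

theorem isFGPeriodicSet_perPos_plane {A : Set (Fin 2 → ℤ)} (hA : A.Finite) :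
    IsFGPeriodicSet (perPos A) := by
  have hP : IsPeriodicSet (perPos A) := isPeriodicSet_perPos
  have hnn : ∀ v ∈ perPos A, 0 ≤ v 0 ∧ 0 ≤ v 1 := fun v hv =>
    ⟨perPos_nonneg hv 0, perPos_nonneg hv 1⟩
  by_cases hx : ∃ x ∈ perPos A, 0 < x 0 ∧ 0 < x 1
  · obtain ⟨x, hx, hx0, hx1⟩ := hx
    obtain ⟨u, hu, hu0, hu'⟩ := exists_extreme_mem_perPos hA (i := 0) (j := 1) (by decide)
      hx hx0 hx1
    obtain ⟨w, hw, hw1, hw'⟩ := exists_extreme_mem_perPos hA (i := 1) (j := 0) (by decide)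
      hx hx1 hx0
    rcases (hu' w hw).eq_or_lt with hdet | hdet
    · refine hP.isFG_of_collinear (fun v hv => perPos_nonneg hv) hx ?_ ?_
      · rintro rfl
        simp at hx0
      -- The extreme vectors are parallel, which squeezes everything onto one line.
      · have key : ∀ v ∈ perPos A, u 0 * v 1 = u 1 * v 0 := by
          intro v hv
          have h1 := hu' v hv
          have h2 := hw' v hv
          have h3 := hnn u hu
          have h4 := hnn w hw
          by_contra hne
          have h5 : 0 < u 0 * v 1 - u 1 * v 0 := by omega
          have e : (w 1 * v 0 - w 0 * v 1) * u 0 = - (w 0 * (u 0 * v 1 - u 1 * v 0)) := by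
            linear_combination -v 0 * hdet
          have h6 : w 0 * (u 0 * v 1 - u 1 * v 0) ≤ 0 := by
            linarith [mul_nonneg h2 hu0.le]
          have h7 : w 0 = 0 := by
            by_contra h
            linarith [mul_pos (lt_of_le_of_ne h4.1 (Ne.symm h)) h5]
          have : 0 < u 0 * w 1 := mul_pos hu0 hw1
          rw [h7] at hdet
          linarith
        intro v hv
        have a1 := key x hx
        have a2 := key v hv
        have : u 0 * (x 0 * v 1 - x 1 * v 0) = 0 := by
          linear_combination x 0 * a2 - v 0 * a1
        rcases mul_eq_zero.1 this with h | h
        · omega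
        · linarith
    -- Cramer's rule.
    · refine hP.isFG_of_cone hu hw (D := (u 0 * w 1 - u 1 * w 0).toNat) (by omega) fun v hv =>
        ⟨(w 1 * v 0 - w 0 * v 1).toNat, (u 0 * v 1 - u 1 * v 0).toNat, ?_⟩
      have e1 := Int.toNat_of_nonneg hdet.le
      have e2 := Int.toNat_of_nonneg (hw' v hv)
      have e3 := Int.toNat_of_nonneg (hu' v hv)
      refine funext (Fin.forall_fin_two.2 ⟨?_, ?_⟩) <;>
        simp only [Pi.add_apply, Pi.nsmul_apply_int, e1, e2, e3] <;> ring
  -- With no positive vector, all elements share one axis: nonzero vectors on different axes would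
  -- have a positive sum.
  · push Not at hx
    by_cases hu : ∃ u ∈ perPos A, u ≠ 0
    · obtain ⟨u, hu, hu0⟩ := hu
      refine hP.isFG_of_collinear (fun v hv => perPos_nonneg hv) hu hu0 fun v hv => ?_
      have a1 := hnn u hu
      have a2 := hnn v hv
      have a3 := hx u hu
      have a4 := hx v hv
      have a5 := hx _ (hP.2 u hu v hv)
      simp only [Pi.add_apply] at a5
      rcases a1.1.eq_or_lt with h | h
      · rcases a2.1.eq_or_lt with h' | h'
        · rw [← h, ← h']; simp
        · have : u 1 = 0 := by have := a5 (by omega); omega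
          rw [← h, this]; simp
      · have : u 1 = 0 := by have := a3 h; omega
        have : v 1 = 0 := by have := a5 (by omega); omega
        simp [*]
    · push Not at hu
      exact hP.isFG_of_cone hP.1 hP.1 one_pos fun v hv => ⟨0, 0, by simp [hu v hv]⟩

end Plane

/-! ### Dimension three -/

section Space

/-- Five vectors in `ℤ³` whose nonnegative sums are not finitely generated. -/
def spaceVectors : Set (Fin 3 → ℤ) :=
  {![1, 1, 1], ![-1, 2, 0], ![-1, 0, 0], ![2, -1, 0], ![0, -1, 0]}

theorem spaceVectors_step {x : Fin 3 → ℤ} (hx : x ∈ perPos spaceVectors) {a y : Fin 3 → ℤ}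
    (ha : a ∈ spaceVectors) (hy : x + a = y) (h0 : 0 ≤ y 0) (h1 : 0 ≤ y 1) (h2 : 0 ≤ y 2) :
    y ∈ perPos spaceVectors := by
  subst hy
  refine add_mem_perPos_of_mem hx ha fun k => ?_
  fin_cases k
  exacts [h0, h1, h2]

/-- `(-1,2,0)` followed by `(2,-1,0)` adds `(1,1,0)`; the first step is legal because the first
coordinate is at least 1. -/
theorem diagonal_mem_perPos_spaceVectors (c k : ℕ) :
    ![(c : ℤ) + 1 + k, c + 1 + k, c + 1] ∈ perPos spaceVectors := by
  induction k with
  | zero =>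
    have h1 : ![1, 1, 1] ∈ perPos spaceVectors :=
      mem_perPos_of_mem (by simp [spaceVectors]) (fun k => by fin_cases k <;> simp)
    convert isPeriodicSet_perPos.nsmul_mem h1 (c + 1) using 1
    ext k
    fin_cases k <;> simp
  | succ k ih =>
    have h : ![(c : ℤ) + k, c + 1 + k + 2, c + 1] ∈ perPos spaceVectors := by
      refine spaceVectors_step ih (a := ![-1, 2, 0]) (by simp [spaceVectors]) ?_ ?_ ?_ ?_
      · ext i; fin_cases i <;> simp; ring
      all_goals simp; positivity
    refine spaceVectors_step h (a := ![2, -1, 0]) (by simp [spaceVectors]) ?_ ?_ ?_ ?_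
    · ext i; fin_cases i <;> simp <;> ring
    all_goals simp; positivity

theorem perPos_spaceVectors :
    perPos spaceVectors = {0} ∪ {v | 0 ≤ v 0 ∧ 0 ≤ v 1 ∧ 0 < v 2} := by
  ext v
  constructor
  · intro hv
    have hnn := perPos_nonneg hv
    obtain ⟨l, hl, hp, rfl⟩ := hv
    cases l with
    | nil => left; rfl
    | cons a l =>
      refine Or.inr ⟨hnn 0, hnn 1, ?_⟩
      have ha := hl a (by simp)
      have ha0 : 0 ≤ a := by simpa using hp 1 (by simp)
      have hl0 : ∀ m : List (Fin 3 → ℤ), (∀ b ∈ m, b ∈ spaceVectors) → 0 ≤ m.sum 2 := by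
        intro m hm
        induction m with
        | nil => simp
        | cons b m ih =>
          rw [List.sum_cons, Pi.add_apply]
          refine add_nonneg ?_ (ih fun c hc => hm c (by simp [hc]))
          have hb := hm b (by simp)
          simp only [spaceVectors, Set.mem_insert_iff, Set.mem_singleton_iff] at hb
          rcases hb with rfl | rfl | rfl | rfl | rfl <;> simp
      have h2 := hl0 l fun b hb => hl b (by simp [hb])
      have ha2 : a 2 = 1 := by
        have b0 := ha0 0
        have b1 := ha0 1
        simp only [spaceVectors, Set.mem_insert_iff, Set.mem_singleton_iff] at ha
        rcases ha with rfl | rfl | rfl | rfl | rfl <;> simp at b0 b1 ⊢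
      rw [List.sum_cons, Pi.add_apply]
      omega
  · rintro (rfl | ⟨h0, h1, h2⟩)
    · exact zero_mem_perPos
    -- The diagonal point at height `v 2` with other coordinates `v 0 + v 1 + v 2` dominates `v`;
    -- the two unit decrements then bring it down to `v`.
    · have hd := diagonal_mem_perPos_spaceVectors (v 2 - 1).toNat (v 0 + v 1).toNat
      have e1 : (((v 2 - 1).toNat : ℕ) : ℤ) = v 2 - 1 := Int.toNat_of_nonneg (by omega)
      have e2 : (((v 0 + v 1).toNat : ℕ) : ℤ) = v 0 + v 1 := Int.toNat_of_nonneg (by omega)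
      have e3 : (((v 2 + v 1).toNat : ℕ) : ℤ) = v 2 + v 1 := Int.toNat_of_nonneg (by omega)
      have e4 : (((v 2 + v 0).toNat : ℕ) : ℤ) = v 2 + v 0 := Int.toNat_of_nonneg (by omega)
      rw [e1, e2] at hd
      have hd' := add_nsmul_mem_perPos hd (b := ![-1, 0, 0]) (by simp [spaceVectors])
        (v 2 + v 1).toNat (fun k => by fin_cases k <;> simp [e3] <;> omega)
      convert add_nsmul_mem_perPos hd' (b := ![0, -1, 0]) (by simp [spaceVectors])
        (v 2 + v 0).toNat (fun k => by fin_cases k <;> simp [e3, e4] <;> omega) using 1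
      ext k
      fin_cases k <;> simp [e3, e4] <;> ring

theorem not_isFGPeriodicSet_perPos_spaceVectors : ¬ IsFGPeriodicSet (perPos spaceVectors) := by
  rintro ⟨-, X, hX, hPX⟩
  -- Nonzero elements have height at least 1, so those of height 1 are indecomposable and must be
  -- generators.
  have key : ∀ v ∈ AddSubmonoid.closure X, v 2 = 1 → v ∈ X := by
    intro v hv
    induction hv using AddSubmonoid.closure_induction with
    | mem x hx => exact fun _ => hx
    | zero => simp
    | add x y hx hy ihx ihy =>
      intro h
      have hx' : x ∈ perPos spaceVectors := hPX ▸ hx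
      have hy' : y ∈ perPos spaceVectors := hPX ▸ hy
      rw [perPos_spaceVectors] at hx' hy'
      rw [Pi.add_apply] at h
      rcases hx' with rfl | ⟨-, -, hx'⟩
      · rw [zero_add]
        exact ihy (by simpa using h)
      · rcases hy' with rfl | ⟨-, -, hy'⟩
        · rw [add_zero]
          exact ihx (by simpa using h)
        · omega
  have hinj : Function.Injective fun n : ℕ => (![(n : ℤ), 0, 1] : Fin 3 → ℤ) := by
    intro m n h
    simpa using congrFun h 0
  refine Set.infinite_of_injective_forall_mem hinj (fun n => key _ ?_ (by simp)) hX
  rw [← SetLike.mem_coe, ← hPX, perPos_spaceVectors]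
  right
  simp

end Space

/-! ### Transfer to higher dimensions -/

section Embedding

theorem perPos_image {M N : Type*} [AddCommMonoid M] [PartialOrder M] [AddCommMonoid N]
    [PartialOrder N] (f : M →+ N) (hf : ∀ x, 0 ≤ f x ↔ 0 ≤ x) (A : Set M) :
    perPos (f '' A) = f '' perPos A := by
  have hsum : ∀ (l : List M) (j : ℕ), ((l.map f).take j).sum = f (l.take j).sum := by
    intro l j
    rw [← List.map_take, map_list_sum]
  ext x
  constructor
  · rintro ⟨l, hl, hp, rfl⟩
    obtain ⟨m, hm, rfl⟩ : ∃ m : List M, (∀ a ∈ m, a ∈ A) ∧ m.map f = l := by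
      clear hp
      induction l with
      | nil => exact ⟨[], by simp, rfl⟩
      | cons b l ih =>
        obtain ⟨m, hm, rfl⟩ := ih fun c hc => hl c (by simp [hc])
        obtain ⟨a, ha, rfl⟩ := hl b (by simp)
        exact ⟨a :: m, by simpa using ⟨ha, hm⟩, rfl⟩
    refine ⟨m.sum, ⟨m, hm, fun j hj => ?_, rfl⟩, map_list_sum f m⟩
    rw [← hf, ← hsum]
    exact hp j (by simpa using hj)
  · rintro ⟨_, ⟨l, hl, hp, rfl⟩, rfl⟩
    refine ⟨l.map f, ?_, fun j hj => ?_, (map_list_sum f l).symm⟩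
    · intro b hb
      obtain ⟨a, ha, rfl⟩ := List.mem_map.1 hb
      exact ⟨a, hl a ha, rfl⟩
    · rw [hsum, hf]
      exact hp j (by simpa using hj)

/-- Generators of the image lie in the image, so they pull back along `f`. -/
theorem IsFGPeriodicSet.of_image {M N : Type*} [AddCommMonoid M] [AddCommMonoid N] (f : M →+ N) (hf : Function.Injective f) {P : Set M}
    (hP : IsPeriodicSet P) (h : IsFGPeriodicSet (f '' P)) : IsFGPeriodicSet P := by
  obtain ⟨-, X, hX, hPX⟩ := h
  refine ⟨hP, f ⁻¹' X, hX.preimage hf.injOn, ?_⟩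
  have hsub : X ⊆ f '' P := hPX ▸ AddSubmonoid.subset_closure
  have himg : f '' (f ⁻¹' X) = X :=
    Set.image_preimage_eq_of_subset fun x hx => Set.image_subset_range f P (hsub hx)
  apply hf.image_injective
  rw [hPX, ← AddSubmonoid.coe_map, AddMonoidHom.map_mclosure, himg]

theorem exists_not_isFGPeriodicSet_perPos {d : ℕ} (hd : 3 ≤ d) :
    ∃ A : Set (Fin d → ℤ), A.Finite ∧ ¬ IsFGPeriodicSet (perPos A) := by
  let f : (Fin 3 → ℤ) →+ (Fin d → ℤ) :=
    { toFun := fun v i => if h : (i : ℕ) < 3 then v ⟨i, h⟩ else 0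
      map_zero' := by ext i; simp
      map_add' := fun v w => by
        ext i
        by_cases h : (i : ℕ) < 3 <;> simp [h] }
  have hfv : ∀ v (k : Fin 3), f v (Fin.castLE hd k) = v k := fun v k => by simp [f]
  have hinj : Function.Injective f := by
    intro v w h
    ext k
    rw [← hfv v, ← hfv w, h]
  have hf : ∀ v, 0 ≤ f v ↔ 0 ≤ v := by
    intro v
    constructor
    · intro h k
      rw [← hfv v k]
      exact h _
    · intro h i
      by_cases hi : (i : ℕ) < 3
      · simpa [f, hi] using h ⟨i, hi⟩
      · simp [f, hi]
  refine ⟨f '' spaceVectors, Set.Finite.image _ (by simp [spaceVectors]), fun h => ?_⟩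
  rw [perPos_image f hf] at h
  exact not_isFGPeriodicSet_perPos_spaceVectors
    (IsFGPeriodicSet.of_image f hinj isPeriodicSet_perPos h)

end Embedding

theorem mainTheorem3 :
    (∀ A : Set (Fin 2 → ℤ), A.Finite → IsFGPeriodicSet (perPos A)) ∧
    (perPos ({![1, 1, 1], ![-1, 2, 0], ![-1, 0, 0], ![2, -1, 0], ![0, -1, 0]} :
          Set (Fin 3 → ℤ)) =
        {0} ∪ {v | 0 ≤ v 0 ∧ 0 ≤ v 1 ∧ 0 < v 2} ∧
      ¬ IsFGPeriodicSet (perPos ({![1, 1, 1], ![-1, 2, 0], ![-1, 0, 0], ![2, -1, 0],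
          ![0, -1, 0]} : Set (Fin 3 → ℤ)))) ∧
    (∀ d : ℕ, 3 ≤ d → ∃ A : Set (Fin d → ℤ), A.Finite ∧ ¬ IsFGPeriodicSet (perPos A)) := by
  exact ⟨fun _ hA => isFGPeriodicSet_perPos_plane hA, ⟨perPos_spaceVectors,
    not_isFGPeriodicSet_perPos_spaceVectors⟩, fun _ hd => exists_not_isFGPeriodicSet_perPos hd⟩
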